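/- Let $H_1,H_2$ be real Hilbert spaces, let $f:H_1\to H_1$ be Lipschitz continuous, let $B:H_2\to H_1$, $C:H_1\to H_2$, $D:H_2\to H_2$ be bounded linear operators, and let $\mathcal F:H_2\rightrightarrows H_2$ be a set-valued mapping. Assume: 1. there is a bounded, symmetric linear operator $P:H_1\to H_1$, positive definite in the sense that $\langle Px,x\rangle\ge c\|x\|^2$ for all $x$ and some $c>0$, with $PB=C^T$ (where $C^T$ is the adjoint of $C$), and the mappings $P\circ f$ and $D$ are monotone; 2. $\mathcal F$ is maximal monotone; 3. $0\in\operatorname{ri}\big(\operatorname{rge}C-\operatorname{rge}(\mathcal F^{-1}+D)\big)$, where $\operatorname{ri}S$ is the interior of $S$ relative to its closed affine hull; 4. the set-valued Lur'e system has an equilibrium, i.e. there is $z\in H_1$ with $0\in f(z)+B(\mathcal F^{-1}+D)^{-1}(Cz)$. Put $\tilde f:=P\circ f$ and $G:=C^T(\mathcal F^{-1}+D)^{-1}C$, let $K\ge 0$ be a Lipschitz constant of $\tilde f$, and let $\gamma>0$ satisfy $\gamma K<1$. Then the resolvent $J_{\gamma G}=(I+\gamma G)^{-1}$ is single-valued and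 defined on all of $H_1$, and for every starting point $x_0\in H_1$ the sequence $(x_n)$ generated by $$y_n=J_{\gamma G}\big(x_n-\gamma\tilde f(x_n)\big),\qquad x_{n+1}=y_n-\gamma\big(\tilde f(y_n)-\tilde f(x_n)\big)\qquad(n\ge 0)$$ converges weakly in $H_1$ to an equilibrium $x^*$ of the Lur'e system, that is, to a point $x^*$ with $$0\in f(x^*)+B(\mathcal F^{-1}+D)^{-1}(Cx^*).$$ -/

import Mathlib

open scoped NNReal Pointwise Topology InnerProductSpace

namespace Lure

/-- The inverse of a set-valued mapping: `x ∈ A⁻¹ y` iff `y ∈ A x`. -/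
def inverse {X Y : Type*} (A : X → Set Y) : Y → Set X :=
  fun y => {x | y ∈ A x}

/-- The range of a set-valued mapping. -/
def range {X Y : Type*} (A : X → Set Y) : Set Y :=
  ⋃ x, A x

/-- The graph of a set-valued mapping. -/
def graph {X Y : Type*} (A : X → Set Y) : Set (X × Y) :=
  {p | p.2 ∈ A p.1}

/-- A single-valued mapping regarded as a set-valued one. -/
def single {X Y : Type*} (g : X → Y) : X → Set Y :=
  fun x => {g x}

/-- Monotonicity of a set-valued mapping on a real inner product space. -/
def IsMonotone {H : Type*} [NormedAddCommGroup H] [InnerProductSpace ℝ H]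
    (A : H → Set H) : Prop :=
  ∀ x y : H, ∀ u ∈ A x, ∀ v ∈ A y, 0 ≤ ⟪u - v, x - y⟫_ℝ

/-- A monotone mapping whose graph is not strictly contained in the graph of another
monotone mapping. -/
def IsMaximalMonotone {H : Type*} [NormedAddCommGroup H] [InnerProductSpace ℝ H]
    (A : H → Set H) : Prop :=
  IsMonotone A ∧ ¬ ∃ A' : H → Set H, IsMonotone A' ∧ graph A ⊂ graph A'

/-- Positive definiteness of a bounded operator: `⟪E x, x⟫ ≥ c ‖x‖²` for some `c > 0`. -/
def IsPositiveDefinite {H : Type*} [NormedAddCommGroup H] [InnerProductSpace ℝ H]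
    (E : H →L[ℝ] H) : Prop :=
  ∃ c : ℝ, 0 < c ∧ ∀ x : H, c * ‖x‖ ^ 2 ≤ ⟪E x, x⟫_ℝ

/-- The relative interior of a set in a normed space: its interior relative to its closed
affine hull. In finite dimension every affine hull is closed, and this is the usual
relative interior. -/
def relInterior {E : Type*} [NormedAddCommGroup E] [NormedSpace ℝ E] (S : Set E) : Set E :=
  {x | x ∈ S ∧ ∃ ε : ℝ, 0 < ε ∧ Metric.ball x ε ∩ closure (affineSpan ℝ S : Set E) ⊆ S}

/-- The mapping `F⁻¹ + D`. -/
def invAdd {H : Type*} [AddCommGroup H] (F : H → Set H) (D : H → H) : H → Set H :=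
  fun y => inverse F y + single D y

/-- The composition `M ∘ (F⁻¹ + D)⁻¹ ∘ C`, that is `x ↦ {M w | w ∈ (F⁻¹ + D)⁻¹ (C x)}`. -/
def feedback {X H Z : Type*} [AddCommGroup H] (M : H → Z) (F : H → Set H) (D : H → H)
    (C : X → H) : X → Set Z :=
  fun x => M '' (inverse (invAdd F D) (C x))

/-- `x` is an equilibrium of the set-valued Lur'e system given by `(f, B, C, D, F)`:
`0 ∈ f x + B (F⁻¹ + D)⁻¹ (C x)`. -/
def IsEquilibrium {H₁ H₂ : Type*} [AddCommGroup H₁] [AddCommGroup H₂]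
    (f : H₁ → H₁) (B : H₂ → H₁) (C : H₁ → H₂) (D : H₂ → H₂) (F : H₂ → Set H₂)
    (x : H₁) : Prop :=
  0 ∈ single f x + feedback B F D C x

/-- The resolvent `J_{γ A} = (I + γ A)⁻¹`, as a set-valued mapping. -/
def resolvent {H : Type*} [AddCommGroup H] [Module ℝ H] (γ : ℝ) (A : H → Set H) :
    H → Set H :=
  inverse (fun y => {y} + γ • A y)

/-- `x` (with auxiliary sequence `y`) is generated by the forward-backward-forward iteration
with step size `γ` for the single-valued mapping `g` and the set-valued mapping `G`:
`yₙ = J_{γ G} (xₙ - γ g(xₙ))` and `xₙ₊₁ = yₙ - γ (g(yₙ) - g(xₙ))`. -/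
def IsForwardBackwardForward {H : Type*} [AddCommGroup H] [Module ℝ H] (γ : ℝ)
    (g : H → H) (G : H → Set H) (x y : ℕ → H) : Prop :=
  ∀ n : ℕ, y n ∈ resolvent γ G (x n - γ • g (x n)) ∧
    x (n + 1) = y n - γ • (g (y n) - g (x n))

end Lure

/-!
The preconditioner `P` turns the equilibrium problem into a monotone inclusion: `P` is injective and
`P B = C*`, so equilibria are the zeros of `P ∘ f + G` with `G = C* (F⁻¹ + D)⁻¹ C`
(`Lure.isEquilibrium_iff_neg_mem_feedback`), a sum of a monotone Lipschitz mapping and a monotone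
set-valued one. The analytical content is that `I + γ G` is surjective, and that the
forward-backward-forward iteration converges weakly.

**Surjectivity** (`Lure.exists_add_smul_feedback_eq`). Eliminating `y = z - γ C* w` from
`C y ∈ (F⁻¹ + D) w` leaves an inclusion in `H₂` for `w` alone, with linear part `γ C C* + D`, which
is only monotone. Adding `λ w` makes it strongly monotone, and it is then solvable by Minty's
theorem (`Lure.IsMaximalMonotone.exists_add_smul_eq`) and a contraction argument. Minty's theorem
itself comes from a minimax principle for a quadratic plus linear function on a convex hull
(`Lure.exists_forall_inner_add_nonneg`). As `λ → 0`, monotonicity bounds `-⟪v, w⟫` for every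
`v ∈ rge C - rge (F⁻¹ + D)`. The relative interior condition says that this set contains a ball of
its closed span, and the solutions `w` lie in that span, so the uniform boundedness principle
bounds `‖w‖`. Bounded regularization paths converge strongly
(`Lure.cauchySeq_of_inner_smul_sub_smul_nonpos`), and the graph of `F` is closed.

**Weak convergence** (`Lure.IsForwardBackwardForward.exists_tendsto_weak`). The distances to each
zero decrease, with a gap that forces `x n - y n → 0`
(`Lure.norm_sq_forwardBackwardForward_le`). Weak cluster points are therefore monotonically related
to the graph of `P ∘ f + G` with value zero; they are zeros because `I + γ (P ∘ f + G)` is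
surjective. Opial's lemma (`Lure.exists_tendsto_inner_of_tendsto_norm_sub`) concludes.
-/

namespace Lure

open Filter

/-! ### Maximal monotone mappings and Minty's theorem -/

section MonotoneOperators

variable {H : Type*} [NormedAddCommGroup H] [InnerProductSpace ℝ H]

theorem IsMaximalMonotone.mem_of_forall_inner_nonneg {A : H → Set H} (hA : IsMaximalMonotone A)
    {x u : H} (h : ∀ a, ∀ b ∈ A a, 0 ≤ ⟪b - u, a - x⟫_ℝ) : u ∈ A x := by
  by_contra hu
  refine hA.2 ⟨fun y => A y ∪ {v | y = x ∧ v = u}, ?_, ?_, ?_⟩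
  · rintro y z v (hv | ⟨rfl, rfl⟩) w (hw | ⟨rfl, rfl⟩)
    · exact hA.1 y z v hv w hw
    · exact h y v hv
    · rw [← neg_sub w, ← neg_sub z, inner_neg_neg]
      exact h z w hw
    · simp
  · exact fun p hp => Or.inl hp
  · exact fun hsub => hu (hsub (show (x, u) ∈ graph _ from Or.inr ⟨rfl, rfl⟩))

theorem isMaximalMonotone_of_forall {A : H → Set H} (hA : IsMonotone A)
    (h : ∀ x u, (∀ a, ∀ b ∈ A a, 0 ≤ ⟪b - u, a - x⟫_ℝ) → u ∈ A x) : IsMaximalMonotone A := by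
  refine ⟨hA, ?_⟩
  rintro ⟨A', hA', hsub, hnot⟩
  exact hnot fun p hp => h p.1 p.2 fun a b hb =>
    hA' a p.1 b (hsub (show (a, b) ∈ graph A from hb)) p.2 hp

theorem IsMaximalMonotone.inverse {A : H → Set H} (hA : IsMaximalMonotone A) :
    IsMaximalMonotone (inverse A) := by
  refine isMaximalMonotone_of_forall (fun x y u hu v hv => ?_) fun x u h => ?_
  · rw [real_inner_comm]
    exact hA.1 u v x hu y hv
  · refine hA.mem_of_forall_inner_nonneg (x := u) (u := x) fun a b hb => ?_
    rw [real_inner_comm]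
    exact h b a hb

theorem IsMaximalMonotone.mem_of_tendsto {A : H → Set H} (hA : IsMaximalMonotone A)
    {ι : Type*} {l : Filter ι} [l.NeBot] {x u : ι → H} {x' u' : H} (hx : Tendsto x l (𝓝 x'))
    (hu : Tendsto u l (𝓝 u')) (h : ∀ i, u i ∈ A (x i)) : u' ∈ A x' := by
  refine hA.mem_of_forall_inner_nonneg fun a b hb => ?_
  exact ge_of_tendsto' ((tendsto_const_nhds.sub hu).inner (tendsto_const_nhds.sub hx))
    fun i => hA.1 a (x i) b hb (u i) (h i)

/-- A minimax principle: a family of affine functions `x ↦ 2 ⟪x, p k⟫ - ‖x‖² + c k`, indexed by a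
convex set, admits a common point of nonnegativity as soon as each of them is nonnegative at its
maximizer `x = p k`. The point is the limit of `p k` along a minimizing sequence of
`‖p k‖² + c k`. -/
theorem exists_forall_inner_add_nonneg [CompleteSpace H] {E : Type*} [AddCommGroup E] [Module ℝ E]
    (p : E →ₗ[ℝ] H) (c : E →ₗ[ℝ] ℝ) {S : Set E} (hS : Convex ℝ S) (hne : S.Nonempty)
    (hpos : ∀ k ∈ S, 0 ≤ ‖p k‖ ^ 2 + c k) :
    ∃ x : H, ∀ k ∈ S, 0 ≤ 2 * ⟪x, p k⟫_ℝ - ‖x‖ ^ 2 + c k := by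
  set h : E → ℝ := fun k => ‖p k‖ ^ 2 + c k with hh
  have hbdd : BddBelow (h '' S) := ⟨0, by rintro _ ⟨k, hk, rfl⟩; exact hpos k hk⟩
  set m := sInf (h '' S) with hm
  have hm0 : 0 ≤ m := Real.sInf_nonneg (by rintro _ ⟨k, hk, rfl⟩; exact hpos k hk)
  have hle : ∀ k ∈ S, m ≤ h k := fun k hk => csInf_le hbdd ⟨k, hk, rfl⟩
  have hex : ∀ n : ℕ, ∃ k ∈ S, h k < m + 1 / ((n : ℝ) + 1) := fun n => by
    obtain ⟨_, ⟨k, hk, rfl⟩, hlt⟩ := exists_lt_of_csInf_lt (hne.image h)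
      (show sInf (h '' S) < m + 1 / ((n : ℝ) + 1) from lt_add_of_pos_right _ (by positivity))
    exact ⟨k, hk, hlt⟩
  choose k hkS hk using hex
  have hseg : ∀ a b : E, ∀ t : ℝ, h (a + t • (b - a)) =
      h a + t * (2 * ⟪p a, p b - p a⟫_ℝ + c b - c a) + t ^ 2 * ‖p b - p a‖ ^ 2 := by
    intro a b t
    simp only [hh, map_add, map_smul, map_sub, norm_add_sq_real, norm_smul, inner_smul_right,
      mul_pow, Real.norm_eq_abs, sq_abs, smul_eq_mul]
    ring
  have hsegS : ∀ a ∈ S, ∀ b ∈ S, ∀ t : ℝ, 0 ≤ t → t ≤ 1 → a + t • (b - a) ∈ S :=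
    fun a ha b hb t h0 h1 => hS.add_smul_sub_mem ha hb ⟨h0, h1⟩
  have hone : Tendsto (fun n : ℕ => 1 / ((n : ℝ) + 1)) atTop (𝓝 0) :=
    tendsto_one_div_add_atTop_nhds_zero_nat
  have hcau : CauchySeq fun n => p (k n) := by
    refine cauchySeq_of_le_tendsto_0 (fun N : ℕ => Real.sqrt (4 * (1 / ((N : ℝ) + 1)))) ?_ ?_
    · intro i j N hi hj
      rw [dist_eq_norm]
      refine Real.le_sqrt_of_sq_le ?_
      -- The parallelogram identity: compare the value at the midpoint with the infimum.
      have h1 := hle _ (hsegS _ (hkS j) _ (hkS i) (1 / 2) (by norm_num) (by norm_num))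
      have h2 := hseg (k j) (k i) (1 / 2)
      have h3 := hseg (k j) (k i) 1
      rw [one_smul, add_sub_cancel] at h3
      have h4 : 1 / ((i : ℝ) + 1) ≤ 1 / ((N : ℝ) + 1) := by gcongr
      have h5 : 1 / ((j : ℝ) + 1) ≤ 1 / ((N : ℝ) + 1) := by gcongr
      have h6 := hk i
      have h7 := hk j
      nlinarith
    · simpa using (hone.const_mul 4).sqrt
  obtain ⟨x, hx⟩ := cauchySeq_tendsto_of_complete hcau
  have hhk : Tendsto (fun n => h (k n)) atTop (𝓝 m) := by
    refine tendsto_of_tendsto_of_tendsto_of_le_of_le tendsto_const_nhds ?_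
      (fun n => hle _ (hkS n)) (fun n => (hk n).le)
    simpa using hone.const_add m
  have hck : Tendsto (fun n => c (k n)) atTop (𝓝 (m - ‖x‖ ^ 2)) := by
    refine (hhk.sub (hx.norm.pow 2)).congr fun n => ?_
    simp only [hh]; ring
  refine ⟨x, fun b hb => ?_⟩
  -- First-order optimality of the limit along the segments towards `b`.
  have hopt : ∀ t : ℝ, 0 ≤ t → t ≤ 1 →
      m ≤ m + t * (2 * ⟪x, p b - x⟫_ℝ + c b - (m - ‖x‖ ^ 2)) + t ^ 2 * ‖p b - x‖ ^ 2 := by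
    intro t h0 h1
    refine ge_of_tendsto' (f := fun n => h (k n) +
      t * (2 * ⟪p (k n), p b - p (k n)⟫_ℝ + c b - c (k n)) + t ^ 2 * ‖p b - p (k n)‖ ^ 2)
      (x := atTop) ?_ fun n => ?_
    · have hsub := (tendsto_const_nhds (x := p b)).sub hx
      exact (hhk.add (((((hx.inner hsub).const_mul 2).add_const _).sub hck).const_mul t)).add
        ((hsub.norm.pow 2).const_mul _)
    · rw [← hseg]
      exact hle _ (hsegS _ (hkS n) _ hb t h0 h1)
  have hlin : 0 ≤ 2 * ⟪x, p b - x⟫_ℝ + c b - (m - ‖x‖ ^ 2) := by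
    set q := 2 * ⟪x, p b - x⟫_ℝ + c b - (m - ‖x‖ ^ 2)
    have hlim : Tendsto (fun n : ℕ => q + 1 / ((n : ℝ) + 1) * ‖p b - x‖ ^ 2) atTop (𝓝 q) := by
      simpa using (hone.mul_const (‖p b - x‖ ^ 2)).const_add q
    refine ge_of_tendsto' hlim fun n => ?_
    have ht : (0 : ℝ) < 1 / ((n : ℝ) + 1) := by positivity
    have h1 := hopt _ ht.le (by rw [div_le_one (by positivity)]; linarith [n.cast_nonneg (α := ℝ)])
    have h2 : 0 ≤ 1 / ((n : ℝ) + 1) * (q + 1 / ((n : ℝ) + 1) * ‖p b - x‖ ^ 2) := by nlinarith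
    exact nonneg_of_mul_nonneg_right h2 ht
  rw [inner_sub_right, real_inner_self_eq_norm_sq] at hlin
  linarith

/-- The duality pairing `⟪a, b⟫` at a convex combination of points of a monotone set is at most the
same combination of the pairings. -/
theorem inner_le_of_mem_convexHull {M : Set (H × H)}
    (hM : ∀ p ∈ M, ∀ q ∈ M, 0 ≤ ⟪p.2 - q.2, p.1 - q.1⟫_ℝ) {k : H × H × ℝ}
    (hk : k ∈ convexHull ℝ ((fun p : H × H => (p.1, p.2, ⟪p.1, p.2⟫_ℝ)) '' M)) :
    ⟪k.1, k.2.1⟫_ℝ ≤ k.2.2 := by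
  set S := (fun p : H × H => (p.1, p.2, ⟪p.1, p.2⟫_ℝ)) '' M
  -- Every inequality between a point and `l` is affine in the point, so it extends to the hull.
  have hconv : ∀ l : H × H × ℝ,
      Convex ℝ {k : H × H × ℝ | ⟪k.1, l.2.1⟫_ℝ + ⟪l.1, k.2.1⟫_ℝ ≤ k.2.2 + l.2.2} := by
    intro l k₁ h₁ k₂ h₂ s t hs ht hst
    simp only [Set.mem_ofPred_eq, Prod.fst_add, Prod.snd_add, Prod.smul_fst, Prod.smul_snd,
      inner_add_left, inner_add_right, inner_smul_left, inner_smul_right, smul_eq_mul,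
      RCLike.conj_to_real] at *
    have e : l.2.2 = s * l.2.2 + t * l.2.2 := by rw [← add_mul, hst, one_mul]
    rw [e]
    nlinarith [mul_le_mul_of_nonneg_left h₁ hs, mul_le_mul_of_nonneg_left h₂ ht]
  have h1 : ∀ l ∈ S, ∀ k ∈ convexHull ℝ S,
      ⟪k.1, l.2.1⟫_ℝ + ⟪l.1, k.2.1⟫_ℝ ≤ k.2.2 + l.2.2 := by
    rintro _ ⟨q, hq, rfl⟩
    refine fun k hk => convexHull_min ?_ (hconv _) hk
    rintro _ ⟨p, hp, rfl⟩
    have := hM p hp q hq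
    simp only [inner_sub_left, inner_sub_right] at this
    simp only [Set.mem_ofPred_eq]
    linarith [real_inner_comm p.1 q.2, real_inner_comm p.1 p.2, real_inner_comm q.1 q.2,
      real_inner_comm p.2 q.1]
  have h2 : ⟪k.1, k.2.1⟫_ℝ + ⟪k.1, k.2.1⟫_ℝ ≤ k.2.2 + k.2.2 := by
    refine convexHull_min (fun l hl => ?_) (hconv k) hk
    have := h1 l hl k hk
    simp only [Set.mem_ofPred_eq]
    linarith
  linarith

/-- The Debrunner–Flor form of Minty's theorem: every monotone set `M` admits a point `x` such that
`(x, -x)` is monotonically related to `M`. -/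
theorem exists_forall_inner_add_sub_nonneg [CompleteSpace H] {M : Set (H × H)}
    (hM : ∀ p ∈ M, ∀ q ∈ M, 0 ≤ ⟪p.2 - q.2, p.1 - q.1⟫_ℝ) :
    ∃ x : H, ∀ p ∈ M, 0 ≤ ⟪p.2 + x, p.1 - x⟫_ℝ := by
  rcases M.eq_empty_or_nonempty with rfl | hne
  · exact ⟨0, by simp⟩
  let f : H × H × ℝ →ₗ[ℝ] H :=
    (1 / 2 : ℝ) • (LinearMap.fst ℝ H (H × ℝ) - LinearMap.fst ℝ H ℝ ∘ₗ LinearMap.snd ℝ H (H × ℝ))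
  let c : H × H × ℝ →ₗ[ℝ] ℝ := LinearMap.snd ℝ H ℝ ∘ₗ LinearMap.snd ℝ H (H × ℝ)
  have hf : ∀ k, f k = (1 / 2 : ℝ) • (k.1 - k.2.1) := fun k => rfl
  have hc : ∀ k, c k = k.2.2 := fun k => rfl
  obtain ⟨x, hx⟩ := exists_forall_inner_add_nonneg f c
    (convex_convexHull ℝ ((fun p : H × H => (p.1, p.2, ⟪p.1, p.2⟫_ℝ)) '' M))
    ((hne.image _).convexHull) fun k hk => by
      have h1 := inner_le_of_mem_convexHull hM hk
      have h2 : 0 ≤ ‖k.1 + k.2.1‖ ^ 2 := by positivity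
      rw [hf, hc, norm_smul, mul_pow, norm_sub_sq_real]
      rw [norm_add_sq_real] at h2
      norm_num
      linarith
  refine ⟨x, fun p hp => ?_⟩
  have h := hx _ (subset_convexHull ℝ _ ⟨p, hp, rfl⟩)
  rw [hf, hc] at h
  simp only [inner_smul_right, inner_sub_right] at h
  simp only [inner_sub_right, inner_add_left, real_inner_self_eq_norm_sq]
  rw [real_inner_comm p.1 p.2, real_inner_comm x p.2]
  linarith

/-- Minty's theorem: `I + μ A` is surjective. -/
theorem IsMaximalMonotone.exists_add_smul_eq [CompleteSpace H] {A : H → Set H}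
    (hA : IsMaximalMonotone A) {μ : ℝ} (hμ : 0 < μ) (z : H) :
    ∃ x, ∃ u ∈ A x, x + μ • u = z := by
  obtain ⟨x, hx⟩ := exists_forall_inner_add_sub_nonneg
    (M := (fun p : H × H => (p.1, μ • p.2 - z)) '' graph A) (by
      rintro _ ⟨p, hp, rfl⟩ _ ⟨q, hq, rfl⟩
      have := mul_nonneg hμ.le (hA.1 p.1 q.1 p.2 hp q.2 hq)
      rw [← real_inner_smul_left, smul_sub] at this
      simpa using this)
  refine ⟨x, μ⁻¹ • (z - x), hA.mem_of_forall_inner_nonneg fun a b hb => ?_, ?_⟩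
  · have h := hx _ ⟨(a, b), hb, rfl⟩
    have e : μ • b - z + x = μ • (b - μ⁻¹ • (z - x)) := by
      rw [smul_sub, smul_inv_smul₀ hμ.ne']; abel
    rw [e, real_inner_smul_left] at h
    exact nonneg_of_mul_nonneg_right h hμ
  · rw [smul_inv_smul₀ hμ.ne', add_sub_cancel]

theorem IsMonotone.norm_sub_le {A : H → Set H} (hA : IsMonotone A) {μ : ℝ} (hμ : 0 ≤ μ)
    {x y u v : H} (hu : u ∈ A x) (hv : v ∈ A y) :
    ‖x - y‖ ≤ ‖(x + μ • u) - (y + μ • v)‖ := by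
  have h1 := mul_nonneg hμ (hA x y u hu v hv)
  rw [← real_inner_smul_left, real_inner_comm] at h1
  have h2 : (x + μ • u) - (y + μ • v) = (x - y) + μ • (u - v) := by rw [smul_sub]; abel
  refine le_of_sq_le_sq ?_ (norm_nonneg _)
  rw [h2, norm_add_sq_real]
  nlinarith [sq_nonneg ‖μ • (u - v)‖]

/-- The resolvent of a monotone mapping is nonexpansive, so its composition with a strict contraction
`h` has a fixed point `x`, that is `h x ∈ x + μ A x`. -/
theorem IsMonotone.exists_add_smul_eq_of_contraction [CompleteSpace H] {A : H → Set H}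
    (hA : IsMonotone A) {μ : ℝ} (hμ : 0 < μ) (hres : ∀ z, ∃ x, ∃ u ∈ A x, x + μ • u = z)
    {h : H → H} {q : ℝ≥0} (hq : q < 1)
    (hh : ∀ x y, ‖h x - h y‖ ≤ q * ‖x - y‖) :
    ∃ x, ∃ u ∈ A x, x + μ • u = h x := by
  choose J U hU hJ using hres
  have hcon : ContractingWith q fun x => J (h x) := by
    refine ⟨hq, LipschitzWith.of_dist_le_mul fun x y => ?_⟩
    rw [dist_eq_norm, dist_eq_norm]
    refine (hA.norm_sub_le hμ.le (hU (h x)) (hU (h y))).trans ?_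
    rw [hJ, hJ]
    exact hh x y
  obtain ⟨x, hx⟩ : ∃ x, J (h x) = x := ⟨_, hcon.fixedPoint_isFixedPt⟩
  refine ⟨x, U (h x), ?_, ?_⟩
  · simpa only [hx] using hU (h x)
  · simpa only [hx] using hJ (h x)

/-- A maximal monotone mapping plus a strongly monotone bounded linear operator is surjective. -/
theorem IsMaximalMonotone.exists_sub_mem_of_isPositiveDefinite [CompleteSpace H] {A : H → Set H}
    (hA : IsMaximalMonotone A) {E : H →L[ℝ] H} (hE : IsPositiveDefinite E) (z : H) :
    ∃ x, z - E x ∈ A x := by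
  obtain ⟨c, hc, hcE⟩ := hE
  -- `L` bounds the norm of `E` and exceeds `c`, so that `I - (c / L²) E` contracts by the
  -- factor `√(1 - c² / L²)`.
  set L := ‖E‖ + c with hL
  have hLpos : 0 < L := by positivity
  have hEL : ∀ x, ‖E x‖ ≤ L * ‖x‖ := fun x =>
    (E.le_opNorm x).trans (by gcongr; linarith)
  set μ := c / L ^ 2 with hμ
  have hμpos : 0 < μ := by positivity
  set r := Real.sqrt (1 - c ^ 2 / L ^ 2) with hr
  have hr0 : 0 ≤ r := Real.sqrt_nonneg _
  have hcL : c ^ 2 / L ^ 2 ≤ 1 := by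
    rw [div_le_one (by positivity)]
    have := norm_nonneg E
    gcongr; linarith
  have hr2 : r ^ 2 = 1 - c ^ 2 / L ^ 2 := Real.sq_sqrt (by linarith)
  have hr1 : r < 1 := by
    have : 0 < c ^ 2 / L ^ 2 := by positivity
    nlinarith
  have hcon : ∀ d, ‖d - μ • E d‖ ≤ r * ‖d‖ := by
    intro d
    refine le_of_sq_le_sq ?_ (by positivity)
    rw [mul_pow, hr2, norm_sub_sq_real, norm_smul, mul_pow, inner_smul_right, real_inner_comm,
      Real.norm_eq_abs, sq_abs]
    have h1 : ‖E d‖ ^ 2 ≤ L ^ 2 * ‖d‖ ^ 2 := by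
      rw [← mul_pow]; exact pow_le_pow_left₀ (norm_nonneg _) (hEL d) 2
    have h2 := mul_le_mul_of_nonneg_left h1 (sq_nonneg μ)
    have h3 := mul_le_mul_of_nonneg_left (hcE d) hμpos.le
    have h4 : μ ^ 2 * (L ^ 2 * ‖d‖ ^ 2) = c ^ 2 / L ^ 2 * ‖d‖ ^ 2 := by
      rw [hμ]; field_simp
    have h5 : μ * (c * ‖d‖ ^ 2) = c ^ 2 / L ^ 2 * ‖d‖ ^ 2 := by
      rw [hμ]; field_simp
    nlinarith
  obtain ⟨x, u, hu, hx⟩ := hA.1.exists_add_smul_eq_of_contraction hμpos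
    (hA.exists_add_smul_eq hμpos) (h := fun x => x - μ • (E x - z)) (q := ⟨r, hr0⟩) hr1
    (fun x y => by
      have : x - μ • (E x - z) - (y - μ • (E y - z)) = (x - y) - μ • E (x - y) := by
        rw [map_sub]; module
      rw [this]; exact hcon _)
  have : μ • u = μ • (z - E x) := by
    have h1 : μ • u = (x + μ • u) - x := by abel
    rw [h1, hx]; module
  exact ⟨x, smul_right_injective H hμpos.ne' this ▸ hu⟩

end MonotoneOperators

/-! ### Weak convergence in Hilbert spaces -/

section WeakConvergence

variable {H : Type*} [NormedAddCommGroup H] [InnerProductSpace ℝ H]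

theorem tendsto_toWeakSpace_of_forall_inner [CompleteSpace H] {ι : Type*} {l : Filter ι}
    {x : ι → H} {x' : H} (h : ∀ v, Tendsto (fun n => ⟪x n, v⟫_ℝ) l (𝓝 ⟪x', v⟫_ℝ)) :
    Tendsto (fun n => toWeakSpace ℝ H (x n)) l (𝓝 (toWeakSpace ℝ H x')) := by
  refine (WeakBilin.tendsto_iff_forall_eval_tendsto (B := (topDualPairing ℝ H).flip) ?_).2
    fun φ => ?_
  · intro a b hab
    refine ext_inner_right ℝ fun v => ?_
    have := DFunLike.congr_fun hab (innerSL ℝ v)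
    rw [real_inner_comm, real_inner_comm v b]
    exact this
  · have e : ∀ y, φ y = ⟪y, (InnerProductSpace.toDual ℝ H).symm φ⟫_ℝ := fun y => by
      rw [real_inner_comm, InnerProductSpace.toDual_symm_apply]
    have := h ((InnerProductSpace.toDual ℝ H).symm φ)
    simp only [← e] at this
    exact this

theorem exists_tendsto_inner_of_norm_le [CompleteSpace H] {ι : Type*} (U : Ultrafilter ι)
    {x : ι → H} {R : ℝ} (hx : ∀ n, ‖x n‖ ≤ R) :
    ∃ x', ∀ v, Tendsto (fun n => ⟪x n, v⟫_ℝ) U (𝓝 ⟪x', v⟫_ℝ) := by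
  have hc := WeakDual.isCompact_closedBall (𝕜 := ℝ) (E := H) 0 R
  obtain ⟨φ, -, hφ⟩ := hc.ultrafilter_le_nhds
    (U.map fun n => StrongDual.toWeakDual (InnerProductSpace.toDual ℝ H (x n))) (by
      rw [le_principal_iff, Ultrafilter.mem_coe, Ultrafilter.mem_map]
      refine univ_mem' fun n => ?_
      simpa using hx n)
  refine ⟨(InnerProductSpace.toDual ℝ H).symm (WeakDual.toStrongDual φ), fun v => ?_⟩
  rw [InnerProductSpace.toDual_symm_apply]
  exact ((WeakDual.eval_continuous v).tendsto φ).comp hφ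

/-- Opial's lemma, with the weak cluster points described as weak limits along ultrafilters. -/
theorem exists_tendsto_inner_of_tendsto_norm_sub [CompleteSpace H] {x : ℕ → H} {Z : Set H} {R : ℝ}
    (hx : ∀ n, ‖x n‖ ≤ R)
    (hconv : ∀ z ∈ Z, ∃ r, Tendsto (fun n => ‖x n - z‖) atTop (𝓝 r))
    (hZ : ∀ U : Ultrafilter ℕ, (U : Filter ℕ) ≤ atTop → ∀ x',
      (∀ v, Tendsto (fun n => ⟪x n, v⟫_ℝ) U (𝓝 ⟪x', v⟫_ℝ)) → x' ∈ Z) :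
    ∃ x' ∈ Z, ∀ v, Tendsto (fun n => ⟪x n, v⟫_ℝ) atTop (𝓝 ⟪x', v⟫_ℝ) := by
  have huniq : ∀ U U' : Ultrafilter ℕ, (U : Filter ℕ) ≤ atTop → (U' : Filter ℕ) ≤ atTop →
      ∀ a b, (∀ v, Tendsto (fun n => ⟪x n, v⟫_ℝ) U (𝓝 ⟪a, v⟫_ℝ)) →
      (∀ v, Tendsto (fun n => ⟪x n, v⟫_ℝ) U' (𝓝 ⟪b, v⟫_ℝ)) → a = b := by
    intro U U' hU hU' a b ha hb
    obtain ⟨r, hr⟩ := hconv a (hZ U hU a ha)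
    obtain ⟨s, hs⟩ := hconv b (hZ U' hU' b hb)
    -- The distances to `a` and to `b` determine `⟪x n, a - b⟫` up to constants.
    have hlim : Tendsto (fun n => ⟪x n, a - b⟫_ℝ) atTop
        (𝓝 ((s ^ 2 - r ^ 2 + (‖a‖ ^ 2 - ‖b‖ ^ 2)) / 2)) := by
      refine ((((hs.pow 2).sub (hr.pow 2)).add_const _).div_const 2).congr fun n => ?_
      rw [norm_sub_sq_real, norm_sub_sq_real, inner_sub_right]
      ring
    have h1 := tendsto_nhds_unique (ha (a - b)) (hlim.mono_left hU)
    have h2 := tendsto_nhds_unique (hb (a - b)) (hlim.mono_left hU')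
    rw [← sub_eq_zero, ← inner_self_eq_zero (𝕜 := ℝ), inner_sub_left, h1, h2, sub_self]
  obtain ⟨x', hx'⟩ := exists_tendsto_inner_of_norm_le (Ultrafilter.of (atTop : Filter ℕ)) hx
  refine ⟨x', hZ _ (Ultrafilter.of_le _) x' hx', fun v => ?_⟩
  rw [tendsto_iff_ultrafilter]
  intro U hU
  obtain ⟨a, ha⟩ := exists_tendsto_inner_of_norm_le U hx
  rw [huniq _ U (Ultrafilter.of_le _) hU x' a hx' ha]
  exact ha v

/-- If `x n` converges weakly and is bounded, and `w n` converges strongly, the inner products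
converge. -/
theorem tendsto_inner_of_weak_of_strong {ι : Type*} {l : Filter ι} {x w : ι → H}
    {x' w' : H} {R : ℝ} (hx : ∀ n, ‖x n‖ ≤ R)
    (h : ∀ v, Tendsto (fun n => ⟪x n, v⟫_ℝ) l (𝓝 ⟪x', v⟫_ℝ)) (hw : Tendsto w l (𝓝 w')) :
    Tendsto (fun n => ⟪x n, w n⟫_ℝ) l (𝓝 ⟪x', w'⟫_ℝ) := by
  have h0 : Tendsto (fun n => ⟪x n, w n - w'⟫_ℝ) l (𝓝 0) := by
    have hn : Tendsto (fun n => R * ‖w n - w'‖) l (𝓝 0) := by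
      simpa using (tendsto_iff_norm_sub_tendsto_zero.1 hw).const_mul R
    refine squeeze_zero_norm (fun n => ?_) hn
    exact (norm_inner_le_norm _ _).trans (by gcongr; exact hx n)
  simpa [inner_sub_right] using h0.add (h w')

end WeakConvergence

/-! ### The forward-backward-forward iteration -/

section ForwardBackwardForward

variable {H : Type*} [NormedAddCommGroup H] [InnerProductSpace ℝ H]

theorem mem_resolvent_iff {γ : ℝ} {A : H → Set H} {y z : H} :
    y ∈ resolvent γ A z ↔ ∃ u ∈ A y, y + γ • u = z := by
  simp only [resolvent, inverse, Set.mem_ofPred_eq, Set.singleton_add, Set.mem_image,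
    Set.mem_smul_set]
  constructor
  · rintro ⟨_, ⟨u, hu, rfl⟩, h⟩
    exact ⟨u, hu, h⟩
  · rintro ⟨u, hu, h⟩
    exact ⟨_, ⟨u, hu, rfl⟩, h⟩

/-- The zeros of `g + G` are the points monotonically related to it with value zero. This is the
part of the maximality of `g + G` that the convergence proof uses; it holds because
`I + γ (g + G)` is surjective when `γ` times the Lipschitz constant of `g` is below one. -/
theorem IsMonotone.neg_mem_of_forall_inner_nonneg [CompleteSpace H] {G : H → Set H}
    (hG : IsMonotone G) {g : H → H} {K : ℝ≥0} (hg : LipschitzWith K g) {γ : ℝ} (hγ : 0 < γ)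
    (hγK : γ * K < 1) (hres : ∀ z, ∃ x, ∃ u ∈ G x, x + γ • u = z) {x : H}
    (h : ∀ a, ∀ b ∈ G a, 0 ≤ ⟪g a + b, a - x⟫_ℝ) : -g x ∈ G x := by
  obtain ⟨a, b, hb, hab⟩ := hG.exists_add_smul_eq_of_contraction hγ hres
    (h := fun a => x - γ • g a) (q := ⟨γ * K, by positivity⟩) hγK (fun a b => by
      have : x - γ • g a - (x - γ • g b) = γ • (g b - g a) := by rw [smul_sub]; abel
      rw [this, norm_smul, Real.norm_of_nonneg hγ.le, norm_sub_rev a b]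
      calc γ * ‖g b - g a‖ ≤ γ * (K * ‖b - a‖) := by gcongr; exact hg.norm_sub_le b a
        _ = γ * K * ‖b - a‖ := by ring)
  have e : γ • (g a + b) = -(a - x) := by
    rw [smul_add, eq_sub_of_add_eq' hab]; abel
  have h1 := mul_nonneg hγ.le (h a b hb)
  rw [← real_inner_smul_left, e, inner_neg_left, real_inner_self_eq_norm_sq] at h1
  have h2 : a - x = 0 := by
    rw [← norm_eq_zero]; nlinarith [norm_nonneg (a - x)]
  obtain rfl := sub_eq_zero.1 h2
  rw [sub_self, neg_zero, smul_eq_zero_iff_right hγ.ne'] at e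
  rwa [← eq_neg_of_add_eq_zero_right e]

/-- One step of the forward-backward-forward iteration does not increase the distance to a zero
of `g + G` when `γ K ≤ 1`, and decreases it by a multiple of the residual when `γ K < 1`. -/
theorem norm_sq_forwardBackwardForward_le {G : H → Set H} (hG : IsMonotone G) {g : H → H}
    (hgm : ∀ a b, 0 ≤ ⟪g a - g b, a - b⟫_ℝ) {K : ℝ≥0} (hg : LipschitzWith K g) {γ : ℝ}
    (hγ : 0 < γ) {x y u z : H} (hu : u ∈ G y) (hy : y + γ • u = x - γ • g x)
    (hz : -g z ∈ G z) :
    ‖y - γ • (g y - g x) - z‖ ^ 2 ≤ ‖x - z‖ ^ 2 - (1 - (γ * K) ^ 2) * ‖x - y‖ ^ 2 := by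
  set x₁ := y - γ • (g y - g x) with hx₁
  have e1 : x - x₁ = γ • ((u - -g z) + (g y - g z)) := by
    have : x = y + γ • u + γ • g x := by rw [hy]; abel
    rw [hx₁]
    nth_rewrite 1 [this]
    module
  have h1 : 0 ≤ ⟪x - x₁, y - z⟫_ℝ := by
    rw [e1, real_inner_smul_left, inner_add_left]
    exact mul_nonneg hγ.le (add_nonneg (hG y z u hu _ hz) (hgm y z))
  have h2 : ‖x₁ - y‖ ^ 2 ≤ (γ * K) ^ 2 * ‖x - y‖ ^ 2 := by
    rw [← mul_pow]
    refine pow_le_pow_left₀ (norm_nonneg _) ?_ 2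
    have : x₁ - y = γ • (g x - g y) := by rw [hx₁]; module
    rw [this, norm_smul, Real.norm_of_nonneg hγ.le, mul_assoc]
    gcongr
    exact hg.norm_sub_le x y
  have h3 : ‖x - z‖ ^ 2 = ‖x₁ - z‖ ^ 2 + ‖x - y‖ ^ 2 - ‖x₁ - y‖ ^ 2
      + 2 * ⟪x - x₁, y - z⟫_ℝ := by
    have a1 : x - z = (x - x₁) + (x₁ - y) + (y - z) := by abel
    have a2 : x₁ - z = (x₁ - y) + (y - z) := by abel
    have a3 : x - y = (x - x₁) + (x₁ - y) := by abel
    rw [a1, a2, a3]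
    simp only [norm_add_sq_real, inner_add_left]
    ring
  linarith

/-- Weak convergence of the forward-backward-forward iteration, for a mapping `G` whose resolvent
is everywhere defined. -/
theorem IsForwardBackwardForward.exists_tendsto_weak [CompleteSpace H] {G : H → Set H}
    (hG : IsMonotone G) {g : H → H} (hgm : ∀ a b, 0 ≤ ⟪g a - g b, a - b⟫_ℝ) {K : ℝ≥0}
    (hg : LipschitzWith K g) {γ : ℝ} (hγ : 0 < γ) (hγK : γ * K < 1)
    (hres : ∀ z, ∃ x, ∃ u ∈ G x, x + γ • u = z) (hzero : ∃ z, -g z ∈ G z) {x y : ℕ → H}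
    (h : IsForwardBackwardForward γ g G x y) :
    ∃ x', -g x' ∈ G x' ∧
      Tendsto (fun n => toWeakSpace ℝ H (x n)) atTop (𝓝 (toWeakSpace ℝ H x')) := by
  have hy : ∀ n, ∃ u ∈ G (y n), y n + γ • u = x n - γ • g (x n) :=
    fun n => mem_resolvent_iff.1 (h n).1
  choose u hu hyu using hy
  set δ := 1 - (γ * K) ^ 2 with hδ
  have hγK0 : 0 ≤ γ * K := by positivity
  have hδ0 : 0 < δ := by nlinarith
  have hstep : ∀ z, -g z ∈ G z → ∀ n,
      ‖x (n + 1) - z‖ ^ 2 ≤ ‖x n - z‖ ^ 2 - δ * ‖x n - y n‖ ^ 2 := fun z hz n => by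
    rw [(h n).2]
    exact norm_sq_forwardBackwardForward_le hG hgm hg hγ (hu n) (hyu n) hz
  have hanti : ∀ z, -g z ∈ G z → Antitone fun n => ‖x n - z‖ := fun z hz =>
    antitone_nat_of_succ_le fun n => by
      refine le_of_sq_le_sq ?_ (norm_nonneg _)
      have := mul_nonneg hδ0.le (sq_nonneg ‖x n - y n‖)
      linarith [hstep z hz n]
  have hconv : ∀ z, -g z ∈ G z → ∃ r, Tendsto (fun n => ‖x n - z‖) atTop (𝓝 r) := fun z hz =>
    ⟨_, tendsto_atTop_ciInf (hanti z hz) ⟨0, by rintro _ ⟨n, rfl⟩; exact norm_nonneg _⟩⟩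
  obtain ⟨z, hz⟩ := hzero
  have hbd : ∀ n, ‖x n‖ ≤ ‖x 0 - z‖ + ‖z‖ := fun n => by
    have h1 := hanti z hz (Nat.zero_le n)
    have h2 := norm_le_norm_sub_add (x n) z
    simp only at h1
    linarith
  have hxy : Tendsto (fun n => x n - y n) atTop (𝓝 0) := by
    obtain ⟨r, hr⟩ := hconv z hz
    have h1 : Tendsto (fun n => (‖x n - z‖ ^ 2 - ‖x (n + 1) - z‖ ^ 2) / δ) atTop (𝓝 0) := by
      simpa using (((hr.pow 2).sub ((hr.comp (tendsto_add_atTop_nat 1)).pow 2)).div_const δ)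
    have h2 : Tendsto (fun n => ‖x n - y n‖ ^ 2) atTop (𝓝 0) :=
      squeeze_zero (fun n => by positivity) (fun n => by
        rw [le_div_iff₀ hδ0]; linarith [hstep z hz n]) h1
    rw [tendsto_zero_iff_norm_tendsto_zero]
    simpa [Real.sqrt_sq] using h2.sqrt
  have hgxy : Tendsto (fun n => g (y n) - g (x n)) atTop (𝓝 0) := by
    refine squeeze_zero_norm (fun n => hg.norm_sub_le (y n) (x n)) ?_
    simpa [norm_sub_rev] using (hxy.norm.const_mul (K : ℝ))
  -- `r n` is the element `g (y n) + u n` of `(g + G) (y n)`.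
  set r : ℕ → H := fun n => γ⁻¹ • (x n - y n) + (g (y n) - g (x n)) with hr
  have hru : ∀ n, r n = g (y n) + u n := fun n => by
    have : u n = γ⁻¹ • (x n - γ • g (x n) - y n) := by
      rw [← hyu n, add_sub_cancel_left, inv_smul_smul₀ hγ.ne']
    simp only [hr]
    rw [this, smul_sub, smul_sub, smul_sub, inv_smul_smul₀ hγ.ne']
    abel
  have hr0 : Tendsto r atTop (𝓝 0) := by
    simpa using (hxy.const_smul γ⁻¹).add hgxy
  obtain ⟨x', hx', hlim⟩ := exists_tendsto_inner_of_tendsto_norm_sub (Z := {z | -g z ∈ G z})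
    hbd hconv (by
      intro U hU x' hx'
      refine hG.neg_mem_of_forall_inner_nonneg hg hγ hγK hres fun a b hb => ?_
      have hlim : Tendsto (fun n => ⟪a - x n, g a + b - r n⟫_ℝ + ⟪x n - y n, g a + b - r n⟫_ℝ) U
          (𝓝 (⟪a - x', g a + b - 0⟫_ℝ + ⟪(0 : H), g a + b - 0⟫_ℝ)) := by
        have hs : Tendsto (fun n => g a + b - r n) U (𝓝 (g a + b - 0)) :=
          tendsto_const_nhds.sub (hr0.mono_left hU)
        refine Tendsto.add ?_ ((hxy.mono_left hU).inner hs)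
        simp only [inner_sub_left]
        exact (tendsto_const_nhds.inner hs).sub (tendsto_inner_of_weak_of_strong hbd hx' hs)
      rw [inner_zero_left, add_zero, sub_zero, real_inner_comm] at hlim
      refine ge_of_tendsto' hlim fun n => ?_
      rw [← inner_add_left, sub_add_sub_cancel, real_inner_comm, hru]
      have e : g a + b - (g (y n) + u n) = (b - u n) + (g a - g (y n)) := by abel
      rw [e, inner_add_left]
      exact add_nonneg (hG _ _ _ hb _ (hu n)) (hgm _ _))
  exact ⟨x', hx', tendsto_toWeakSpace_of_forall_inner hlim⟩

end ForwardBackwardForward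

/-! ### Regularization -/

section Regularization

variable {H : Type*} [NormedAddCommGroup H] [InnerProductSpace ℝ H]

/-- Vectors `w i` of a closed subspace are bounded if they are bounded, on one side only, as
functionals at each point of a small ball of that subspace. -/
theorem exists_norm_le_of_forall_neg_inner_le [CompleteSpace H] {ι : Type*} {V : Submodule ℝ H}
    (hV : IsClosed (V : Set H)) {w : ι → H} (hw : ∀ i, w i ∈ V) {ε : ℝ} (hε : 0 < ε)
    (h : ∀ v ∈ V, ‖v‖ < ε → ∃ M, ∀ i, -⟪v, w i⟫_ℝ ≤ M) : ∃ R, ∀ i, ‖w i‖ ≤ R := by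
  have : CompleteSpace V := hV.completeSpace_coe
  obtain ⟨R, hR⟩ := banach_steinhaus (g := fun i => innerSL ℝ (⟨w i, hw i⟩ : V)) fun v => by
    set t : ℝ := ε / (2 * (‖v‖ + 1)) with ht
    have ht0 : 0 < t := by positivity
    have htv : ‖t • (v : H)‖ < ε := by
      rw [norm_smul, Real.norm_of_nonneg ht0.le, ht, div_mul_eq_mul_div, div_lt_iff₀ (by positivity),
        Submodule.norm_coe]
      nlinarith [norm_nonneg v]
    obtain ⟨M₁, h₁⟩ := h (t • (v : H)) (V.smul_mem _ v.2) htv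
    obtain ⟨M₂, h₂⟩ := h (-(t • (v : H))) (V.neg_mem (V.smul_mem _ v.2)) (by rwa [norm_neg])
    refine ⟨max M₁ M₂ / t, fun i => ?_⟩
    have e : (innerSL ℝ (⟨w i, hw i⟩ : V)) v = ⟪(v : H), w i⟫_ℝ := real_inner_comm _ _
    have a₁ := h₁ i
    have a₂ := h₂ i
    rw [inner_neg_left, neg_neg] at a₂
    rw [real_inner_smul_left] at a₁ a₂
    rw [e, Real.norm_eq_abs, le_div_iff₀ ht0]
    have b₁ := le_max_left M₁ M₂
    have b₂ := le_max_right M₁ M₂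
    rcases abs_cases ⟪(v : H), w i⟫_ℝ with ⟨e', -⟩ | ⟨e', -⟩ <;> rw [e'] <;> linarith
  refine ⟨R, fun i => ?_⟩
  have := hR i
  rwa [innerSL_apply_norm] at this

/-- Convergence of a regularization path: if `⟪w m - w n, l m • w m - l n • w n⟫ ≤ 0` for
nonincreasing positive parameters `l`, then `‖w n‖` is nondecreasing and
`‖w n - w m‖² ≤ ‖w n‖² - ‖w m‖²` for `m ≤ n`. -/
theorem cauchySeq_of_inner_smul_sub_smul_nonpos {l : ℕ → ℝ} (hl : ∀ n, 0 < l n)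
    (hanti : Antitone l) {w : ℕ → H} {R : ℝ} (hR : ∀ n, ‖w n‖ ≤ R)
    (h : ∀ m n, ⟪w m - w n, l m • w m - l n • w n⟫_ℝ ≤ 0) : CauchySeq w := by
  have key : ∀ m n, m ≤ n → ‖w n - w m‖ ^ 2 ≤ ‖w n‖ ^ 2 - ‖w m‖ ^ 2 := by
    intro m n hmn
    have h1 := h m n
    have h2 : 2 * ⟪w m - w n, l m • w m - l n • w n⟫_ℝ =
        (l m + l n) * ‖w n - w m‖ ^ 2 + (l m - l n) * (‖w m‖ ^ 2 - ‖w n‖ ^ 2) := by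
      simp only [inner_sub_left, inner_sub_right, real_inner_smul_right,
        real_inner_self_eq_norm_sq, norm_sub_sq_real]
      rw [real_inner_comm (w m) (w n)]
      ring
    have h3 := hanti hmn
    have h4 := hl m
    have h5 := hl n
    rcases eq_or_ne (w n) (w m) with heq | hne
    · simp [heq]
    · have h6 : 0 < ‖w n - w m‖ ^ 2 := by
        have := norm_pos_iff.2 (sub_ne_zero.2 hne)
        positivity
      have h7 : 0 < ‖w n‖ ^ 2 - ‖w m‖ ^ 2 := by
        refine pos_of_mul_pos_right (a := l m - l n) ?_ (by linarith)
        have := mul_pos (add_pos h4 h5) h6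
        linarith
      have h8 := mul_pos h5 h7
      refine le_of_mul_le_mul_left ?_ (add_pos h4 h5)
      linarith
  have hmono : Monotone fun n => ‖w n‖ ^ 2 := fun m n hmn => by
    have := key m n hmn
    have h6 : 0 ≤ ‖w n - w m‖ ^ 2 := by positivity
    simp only
    linarith
  have hlim := tendsto_atTop_ciSup hmono
    ⟨R ^ 2, by rintro _ ⟨n, rfl⟩; exact pow_le_pow_left₀ (norm_nonneg _) (hR n) 2⟩
  set s := ⨆ n, ‖w n‖ ^ 2
  refine cauchySeq_of_le_tendsto_0' (fun n => Real.sqrt (s - ‖w n‖ ^ 2)) ?_ ?_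
  · intro m n hmn
    rw [dist_comm, dist_eq_norm]
    refine Real.le_sqrt_of_sq_le ((key m n hmn).trans ?_)
    linarith [hmono.ge_of_tendsto hlim n]
  · simpa using (hlim.const_sub s).sqrt

end Regularization

/-! ### The feedback mapping `C* (F⁻¹ + D)⁻¹ C` -/

section Feedback

variable {H₁ H₂ : Type*} [NormedAddCommGroup H₁] [InnerProductSpace ℝ H₁]
  [NormedAddCommGroup H₂] [InnerProductSpace ℝ H₂]

theorem mem_invAdd_iff {H : Type*} [AddCommGroup H] {F : H → Set H} {D : H → H} {w u : H} :
    u ∈ invAdd F D w ↔ w ∈ F (u - D w) := by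
  simp only [invAdd, single, inverse, Set.add_singleton, Set.mem_image, Set.mem_ofPred_eq]
  constructor
  · rintro ⟨v, hv, rfl⟩
    simpa using hv
  · exact fun h => ⟨_, h, sub_add_cancel _ _⟩

theorem mem_feedback_iff {X H Z : Type*} [AddCommGroup H] {M : H → Z} {F : H → Set H}
    {D : H → H} {C : X → H} {x : X} {z : Z} :
    z ∈ feedback M F D C x ↔ ∃ w, C x ∈ invAdd F D w ∧ M w = z :=
  Iff.rfl

theorem IsMonotone.invAdd {F : H₂ → Set H₂} {D : H₂ → H₂} (hF : IsMonotone F)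
    (hD : IsMonotone (single D)) : IsMonotone (invAdd F D) := by
  intro x y u hu v hv
  have h1 := hF _ _ x (mem_invAdd_iff.1 hu) y (mem_invAdd_iff.1 hv)
  have h2 := hD x y _ rfl _ rfl
  have e : u - v = ((u - D x) - (v - D y)) + (D x - D y) := by abel
  rw [e, inner_add_left, real_inner_comm]
  exact add_nonneg h1 h2

variable [CompleteSpace H₁] [CompleteSpace H₂]

theorem IsMonotone.feedback_adjoint {F : H₂ → Set H₂} {D : H₂ → H₂} (hF : IsMonotone F)
    (hD : IsMonotone (single D)) (C : H₁ →L[ℝ] H₂) :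
    IsMonotone (feedback (ContinuousLinearMap.adjoint C) F D C) := by
  rintro x y _ ⟨w, hw, rfl⟩ _ ⟨v, hv, rfl⟩
  rw [← map_sub, ContinuousLinearMap.adjoint_inner_left, map_sub, real_inner_comm]
  exact hF.invAdd hD w v _ hw _ hv

/-- The regularized problem: the inclusion `C y ∈ λ w + (F⁻¹ + D) w` with `y = z - γ C* w`. Its
linear part `λ + γ C C* + D` is strongly monotone. -/
theorem exists_sub_smul_mem_invAdd {F : H₂ → Set H₂} (hF : IsMaximalMonotone F)
    {D : H₂ →L[ℝ] H₂} (hD : IsMonotone (single D)) (C : H₁ →L[ℝ] H₂) {γ l : ℝ} (hγ : 0 ≤ γ)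
    (hl : 0 < l) (z : H₁) :
    ∃ w, C (z - γ • ContinuousLinearMap.adjoint C w) - l • w ∈ invAdd F D w := by
  obtain ⟨w, hw⟩ := hF.inverse.exists_sub_mem_of_isPositiveDefinite
    (E := l • ContinuousLinearMap.id ℝ H₂ + γ • (C ∘L ContinuousLinearMap.adjoint C) + D)
    ⟨l, hl, fun x => by
      have h1 := hD x 0 _ rfl _ rfl
      have h2 : 0 ≤ γ * ‖ContinuousLinearMap.adjoint C x‖ ^ 2 := by positivity
      rw [map_zero, sub_zero, sub_zero] at h1
      simp only [add_apply, smul_apply,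
        ContinuousLinearMap.id_apply, ContinuousLinearMap.comp_apply, inner_add_left,
        real_inner_smul_left, real_inner_self_eq_norm_sq]
      rw [← ContinuousLinearMap.adjoint_inner_right, real_inner_self_eq_norm_sq]
      linarith⟩ (C z)
  refine ⟨w, mem_invAdd_iff.2 ?_⟩
  have e : C (z - γ • ContinuousLinearMap.adjoint C w) - l • w - D w =
      C z - (l • ContinuousLinearMap.id ℝ H₂ + γ • (C ∘L ContinuousLinearMap.adjoint C) + D) w := by
    simp only [add_apply, smul_apply,
      ContinuousLinearMap.id_apply, ContinuousLinearMap.comp_apply, map_sub, map_smul]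
    abel
  rw [e]
  exact hw

/-- A bound, uniform in `l ∈ (0, 1]`, of the solutions of the regularized problem, tested against
an element `C a - b` of `rge C - rge (F⁻¹ + D)`. -/
theorem neg_inner_le_of_sub_smul_mem {A : H₂ → Set H₂} (hA : IsMonotone A) (C : H₁ →L[ℝ] H₂)
    {γ : ℝ} (hγ : 0 < γ) (z a : H₁) {b t : H₂} (hb : b ∈ A t) {l : ℝ} (hl : 0 < l) (hl1 : l ≤ 1)
    {w : H₂} (hw : C (z - γ • ContinuousLinearMap.adjoint C w) - l • w ∈ A w) :
    -⟪C a - b, w⟫_ℝ ≤ ‖z - a - γ • ContinuousLinearMap.adjoint C t‖ ^ 2 / (4 * γ) + ‖t‖ ^ 2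
      - ⟪C a - b, t⟫_ℝ := by
  set y := z - γ • ContinuousLinearMap.adjoint C w with hy
  set e := z - a - γ • ContinuousLinearMap.adjoint C t with he
  have h1 := hA w t _ hw b hb
  have h2 : C y - l • w - b = C (y - a) - l • w + (C a - b) := by
    rw [map_sub C y a]; abel
  rw [h2, inner_add_left, inner_sub_left, ← ContinuousLinearMap.adjoint_inner_right,
    inner_sub_right (C a - b), real_inner_smul_left, inner_sub_right w,
    real_inner_self_eq_norm_sq] at h1
  have h3 : γ • ContinuousLinearMap.adjoint C (w - t) = e - (y - a) := by
    rw [he, hy, map_sub]; module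
  have h4 : γ * ⟪y - a, ContinuousLinearMap.adjoint C (w - t)⟫_ℝ ≤ ‖e‖ ^ 2 / 4 := by
    rw [← real_inner_smul_right, h3, inner_sub_right, real_inner_self_eq_norm_sq]
    have : 0 ≤ ‖(2 : ℝ) • (y - a) - e‖ ^ 2 := by positivity
    rw [norm_sub_sq_real, norm_smul, real_inner_smul_left, mul_pow] at this
    norm_num at this
    linarith
  have h5 : ⟪y - a, ContinuousLinearMap.adjoint C (w - t)⟫_ℝ ≤ ‖e‖ ^ 2 / (4 * γ) := by
    rw [le_div_iff₀ (by positivity)]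
    linarith
  have h6 : l * (⟪w, t⟫_ℝ - ‖w‖ ^ 2) ≤ ‖t‖ ^ 2 := by
    have : 0 ≤ ‖w - t‖ ^ 2 := by positivity
    rw [norm_sub_sq_real] at this
    nlinarith [sq_nonneg ‖w‖, sq_nonneg ‖t‖]
  linarith

/-- Range condition for the feedback mapping `C* (F⁻¹ + D)⁻¹ C`. The solutions `w n` of the
regularized problems stay bounded, by the uniform boundedness principle on the closed span of
`rge C - rge (F⁻¹ + D)`, hence converge strongly, and their limit solves the problem itself. -/
theorem exists_add_smul_feedback_eq {F : H₂ → Set H₂} (hF : IsMaximalMonotone F)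
    {D : H₂ →L[ℝ] H₂} (hD : IsMonotone (single D)) (C : H₁ →L[ℝ] H₂)
    (hri : (0 : H₂) ∈ relInterior (Set.range C - range (invAdd F D))) {γ : ℝ} (hγ : 0 < γ)
    (z : H₁) :
    ∃ y, ∃ u ∈ feedback (ContinuousLinearMap.adjoint C) F D C y, y + γ • u = z := by
  set S := Set.range C - range (invAdd F D) with hS
  have hA : IsMonotone (invAdd F D) := hF.1.invAdd hD
  set V := (Submodule.span ℝ S).topologicalClosure with hVdef
  set l : ℕ → ℝ := fun n => 1 / ((n : ℝ) + 1) with hl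
  have hl0 : ∀ n, 0 < l n := fun n => by positivity
  have hl1 : ∀ n, l n ≤ 1 := fun n => by
    rw [hl, div_le_one (by positivity)]; linarith [n.cast_nonneg (α := ℝ)]
  have hlanti : Antitone l := fun m n hmn => by
    simp only [hl]; gcongr
  have hltend : Tendsto l atTop (𝓝 0) := tendsto_one_div_add_atTop_nhds_zero_nat
  choose w hw using fun n => exists_sub_smul_mem_invAdd hF hD C hγ.le (hl0 n) z
  have hwV : ∀ n, w n ∈ V := fun n => by
    have : l n • w n ∈ S := ⟨_, ⟨_, rfl⟩, _, Set.mem_iUnion.2 ⟨_, hw n⟩, sub_sub_cancel _ _⟩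
    exact Submodule.le_topologicalClosure _
      ((Submodule.smul_mem_iff _ (hl0 n).ne').1 (Submodule.subset_span this))
  have hbdd : ∃ R, ∀ n, ‖w n‖ ≤ R := by
    obtain ⟨h0, ε, hε, hball⟩ := hri
    refine exists_norm_le_of_forall_neg_inner_le (Submodule.isClosed_topologicalClosure _) hwV hε
      fun v hv hvε => ?_
    have hvS : v ∈ S := by
      refine hball ⟨by simpa using hvε, ?_⟩
      have : (affineSpan ℝ S : Set H₂) = Submodule.span ℝ S := by
        rw [← affineSpan_insert_zero, Set.insert_eq_of_mem h0]
      rw [this]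
      exact hv
    obtain ⟨_, ⟨a, rfl⟩, b, hb, rfl⟩ := hvS
    obtain ⟨t, ht⟩ := Set.mem_iUnion.1 hb
    exact ⟨_, fun n => neg_inner_le_of_sub_smul_mem hA C hγ z a ht (hl0 n) (hl1 n) (hw n)⟩
  obtain ⟨R, hR⟩ := hbdd
  have hcau : CauchySeq w := by
    refine cauchySeq_of_inner_smul_sub_smul_nonpos hl0 hlanti hR fun m n => ?_
    have h1 := hA _ _ _ (hw m) _ (hw n)
    have e : C (z - γ • ContinuousLinearMap.adjoint C (w m)) - l m • w m -
        (C (z - γ • ContinuousLinearMap.adjoint C (w n)) - l n • w n) =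
        -(γ • C (ContinuousLinearMap.adjoint C (w m - w n))) - (l m • w m - l n • w n) := by
      simp only [map_sub, map_smul, smul_sub]; abel
    rw [e, inner_sub_left, inner_neg_left, real_inner_smul_left,
      ← ContinuousLinearMap.adjoint_inner_right, real_inner_self_eq_norm_sq,
      real_inner_comm (w m - w n)] at h1
    have : 0 ≤ γ * ‖ContinuousLinearMap.adjoint C (w m - w n)‖ ^ 2 := by positivity
    linarith
  obtain ⟨w', hw'⟩ := cauchySeq_tendsto_of_complete hcau
  have hmem : w' ∈ F (C (z - γ • ContinuousLinearMap.adjoint C w') - (0 : ℝ) • w' - D w') := by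
    refine hF.mem_of_tendsto ?_ hw' fun n => mem_invAdd_iff.1 (hw n)
    refine Tendsto.sub (Tendsto.sub ?_ (hltend.smul hw')) ((D.continuous.tendsto _).comp hw')
    exact ((C.continuous.comp (continuous_const.sub
      ((ContinuousLinearMap.adjoint C).continuous.const_smul γ))).tendsto _).comp hw'
  rw [zero_smul, sub_zero] at hmem
  exact ⟨_, _, mem_feedback_iff.2 ⟨w', mem_invAdd_iff.2 hmem, rfl⟩, sub_add_cancel _ _⟩

end Feedback

/-! ### Equilibria as zeros of a monotone mapping -/

section Equilibria

variable {H₁ H₂ : Type*} [NormedAddCommGroup H₁] [InnerProductSpace ℝ H₁]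
  [NormedAddCommGroup H₂] [InnerProductSpace ℝ H₂]

theorem IsPositiveDefinite.injective {E : H₁ →L[ℝ] H₁} (hE : IsPositiveDefinite E) :
    Function.Injective E := by
  obtain ⟨c, hc, h⟩ := hE
  refine (injective_iff_map_eq_zero E).2 fun x hx => ?_
  have h1 := h x
  rw [hx, inner_zero_left] at h1
  have h2 : ‖x‖ ^ 2 ≤ 0 := nonpos_of_mul_nonpos_right h1 hc
  simpa using le_antisymm h2 (by positivity)

variable [CompleteSpace H₁] [CompleteSpace H₂]

/-- Since `P` is injective and `P B = C*`, equilibria are the zeros of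
`P ∘ f + C* (F⁻¹ + D)⁻¹ C`. -/
theorem isEquilibrium_iff_neg_mem_feedback {f : H₁ → H₁} {B : H₂ →L[ℝ] H₁} {C : H₁ →L[ℝ] H₂}
    {D : H₂ → H₂} {F : H₂ → Set H₂} {P : H₁ →L[ℝ] H₁} (hP : IsPositiveDefinite P)
    (hPB : P ∘L B = ContinuousLinearMap.adjoint C) {x : H₁} :
    IsEquilibrium f B C D F x ↔
      -P (f x) ∈ feedback (ContinuousLinearMap.adjoint C) F D C x := by
  have key : ∀ w, f x + B w = 0 ↔ ContinuousLinearMap.adjoint C w = -P (f x) := fun w => by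
    rw [← hPB, ContinuousLinearMap.comp_apply, eq_neg_iff_add_eq_zero, add_comm, ← map_add,
      map_eq_zero_iff P hP.injective]
  rw [mem_feedback_iff, IsEquilibrium, single, Set.singleton_add]
  constructor
  · rintro ⟨_, ⟨w, hw, rfl⟩, h⟩
    exact ⟨w, hw, (key w).1 h⟩
  · rintro ⟨w, hw, h⟩
    exact ⟨_, ⟨w, hw, rfl⟩, (key w).2 h⟩

end Equilibria

end Lure

theorem theorem3p1
    {H₁ H₂ : Type*}
    [NormedAddCommGroup H₁] [InnerProductSpace ℝ H₁] [CompleteSpace H₁]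
    [NormedAddCommGroup H₂] [InnerProductSpace ℝ H₂] [CompleteSpace H₂]
    (f : H₁ → H₁) (B : H₂ →L[ℝ] H₁) (C : H₁ →L[ℝ] H₂) (D : H₂ →L[ℝ] H₂)
    (F : H₂ → Set H₂) (P : H₁ →L[ℝ] H₁)
    (hf : ∃ L : ℝ≥0, LipschitzWith L f)
    (hPsymm : IsSelfAdjoint P) (hPpos : Lure.IsPositiveDefinite P)
    (hPB : P ∘L B = ContinuousLinearMap.adjoint C)
    (hPf : Lure.IsMonotone (Lure.single fun x => P (f x)))
    (hD : Lure.IsMonotone (Lure.single D))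
    (hF : Lure.IsMaximalMonotone F)
    (hri : (0 : H₂) ∈ Lure.relInterior (Set.range C - Lure.range (Lure.invAdd F D)))
    (hsol : ∃ z : H₁, Lure.IsEquilibrium f B C D F z)
    (γ : ℝ) (hγ : 0 < γ)
    (K : ℝ≥0) (hK : LipschitzWith K fun x => P (f x)) (hγK : γ * K < 1) :
    (∀ z : H₁, ∃! y : H₁,
      y ∈ Lure.resolvent γ (Lure.feedback (ContinuousLinearMap.adjoint C) F D C) z) ∧
    ∀ x y : ℕ → H₁,
      Lure.IsForwardBackwardForward γ (fun u => P (f u))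
        (Lure.feedback (ContinuousLinearMap.adjoint C) F D C) x y →
      ∃ xstar : H₁, Lure.IsEquilibrium f B C D F xstar ∧
        Filter.Tendsto (fun n => toWeakSpace ℝ H₁ (x n)) Filter.atTop
          (𝓝 (toWeakSpace ℝ H₁ xstar)) := by
  have hres := Lure.exists_add_smul_feedback_eq hF hD C hri hγ
  have hG := hF.1.feedback_adjoint hD C
  refine ⟨fun z => ?_, fun x y hxy => ?_⟩
  · obtain ⟨y, u, hu, hy⟩ := hres z
    refine ⟨y, Lure.mem_resolvent_iff.2 ⟨u, hu, hy⟩, fun y' hy' => ?_⟩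
    obtain ⟨u', hu', hy'⟩ := Lure.mem_resolvent_iff.1 hy'
    have := hG.norm_sub_le hγ.le hu' hu
    rw [hy', hy, sub_self, norm_zero] at this
    exact sub_eq_zero.1 (norm_le_zero_iff.1 this)
  · obtain ⟨z, hz⟩ := hsol
    obtain ⟨x', hx', hlim⟩ := hxy.exists_tendsto_weak hG (fun a b => hPf a b _ rfl _ rfl) hK hγ
      hγK hres ⟨z, (Lure.isEquilibrium_iff_neg_mem_feedback hPpos hPB).1 hz⟩
    exact ⟨x', (Lure.isEquilibrium_iff_neg_mem_feedback hPpos hPB).2 hx', hlim⟩
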